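/- Let $\omega=\{0,1,2,\dots\}$. An ideal on a countably infinite set $D$ is a family $\mathcal I\subseteq\mathcal P(D)$ that is closed under subsets and finite unions, contains every finite subset of $D$, and does not contain $D$; put $\mathcal I^\star=\{D\setminus A: A\in\mathcal I\}$. Subsets of $D$ are identified with points of the product space $\{0,1\}^D$, and $\mathbf\Sigma^0_\alpha$ (for $1\le\alpha<\omega_1$) denotes the additive Borel classes of this space, with $\mathbf\Sigma^0_1$ the open sets. The Borel separation rank of $\mathcal I$ is $$\mathrm{rk}(\mathcal I)=\min\{\alpha<\omega_1:\ \text{there is } \mathcal S\in\mathbf\Sigma^0_{1+\alpha}\text{ with }\mathcal I\subseteq\mathcal S\text{ and }\mathcal I^\star\cap\mathcal S=\emptyset\}.$$ Let $\mathrm{Fin}^1$ be the ideal of finite subsets of $\omega$ and, for $n\ge1$, let $\mathrm{Fin}^{n+1}$ be the ideal on $\omega^{n+1}=\omega\times\omega^n$ of all $A$ such that $\{t\in\omega^n:(i,t)\in A\}\notin\mathrm{Fin}^n$ for only finitely many $i\in\omega$. Let $\{X_s:s\in\omega^{n+1}\}$, for $n\in\omega$, be partitions of $\omega$ into infinite sets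 such that $\bigcap_{i\in F}X_{s_i}$ is infinite for every finite $F\subseteq\omega$ and all $s_i\in\omega^{i+1}$ ($i\in F$). For each $n$ let $\mathrm{Fin}^{n+2}(\{X_s:s\in\omega^{n+1}\})$ be the image of $\mathrm{Fin}^{n+2}$ under any bijection $\sigma:\omega^{n+2}\to\omega$ with $\sigma[\{s\}\times\omega]=X_s$ for all $s\in\omega^{n+1}$ (it does not depend on the choice of $\sigma$). Let $\mathrm{Fin}'_\omega$ be the family of all subsets of finite unions of members of $\bigcup_{n\in\omega}\mathrm{Fin}^{n+2}(\{X_s:s\in\omega^{n+1}\})$. **Theorem.** $\mathrm{Fin}'_\omega$ is an ideal on $\omega$, it is $\mathbf\Sigma^0_\omega$ in $\mathcal P(\omega)$, and $\mathrm{rk}(\mathrm{Fin}'_\omega)=\omega$. -/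

import Mathlib

/-- The additive class `Σ⁰_α` (boldface) of the Borel hierarchy of a topological space, `α ≥ 1`:
`Σ⁰_1` consists of the open sets and, for `α > 1`, `Σ⁰_α` consists of the countable unions of sets
whose complements are in classes `Σ⁰_β` with `1 ≤ β < α`. No set is `Σ⁰_0`. -/
inductive IsSigma0 {T : Type*} [TopologicalSpace T] : Ordinal.{0} → Set T → Prop
  | of_isOpen {U : Set T} (hU : IsOpen U) : IsSigma0 1 U
  | iUnion {α : Ordinal.{0}} (hα : 1 < α) (A : ℕ → Set T) (β : ℕ → Ordinal.{0})
      (hβ : ∀ n, 1 ≤ β n ∧ β n < α) (hA : ∀ n, IsSigma0 (β n) (A n)ᶜ) :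
      IsSigma0 α (⋃ n, A n)

/-- A family `S` of subsets of `D` is `Σ⁰_α` in the power set of `D`, where a subset of `D` is
identified with its characteristic function and `D → Bool` carries the product topology. -/
def IsSigma0Family {D : Type*} (α : Ordinal.{0}) (S : Set (Set D)) : Prop :=
  IsSigma0 α {x : D → Bool | {d | x d = true} ∈ S}

/-- `I` is an ideal on the set `D`: proper, and containing all finite subsets of `D`. -/
structure IsIdealOn {D : Type*} (I : Set (Set D)) : Prop where
  subset_mem : ∀ {A B : Set D}, A ⊆ B → B ∈ I → A ∈ I
  union_mem : ∀ {A B : Set D}, A ∈ I → B ∈ I → A ∪ B ∈ I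
  finite_mem : ∀ {A : Set D}, A.Finite → A ∈ I
  univ_notMem : Set.univ ∉ I

/-- The dual family `I⋆` of complements of members of `I`. -/
def dualFamily {D : Type*} (I : Set (Set D)) : Set (Set D) :=
  {B | ∃ A ∈ I, B = Aᶜ}

/-- `α` is the Borel separation rank of `I`: the least `β < ω₁` such that some `Σ⁰_{1+β}` family
contains `I` and is disjoint from `I⋆`. -/
def HasBorelSeparationRank {D : Type*} (I : Set (Set D)) (α : Ordinal.{0}) : Prop :=
  IsLeast {β : Ordinal.{0} | β < Ordinal.omega 1 ∧
    ∃ S : Set (Set D), IsSigma0Family (1 + β) S ∧ I ⊆ S ∧ dualFamily I ∩ S = ∅} α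

/-- The ideal generated by a family `F`: all subsets of unions `F₀ ∪ ⋯ ∪ Fₙ` of members of `F`. -/
def generatedIdeal {D : Type*} (F : Set (Set D)) : Set (Set D) :=
  {A | ∃ n : ℕ, ∃ f : Fin (n + 1) → Set D, (∀ i, f i ∈ F) ∧ A ⊆ ⋃ i, f i}

/-- The ideal of finite sets. -/
def finIdeal (D : Type*) : Set (Set D) := {A | A.Finite}

/-- The Fubini product `I ⊗ J`. -/
def fubiniProduct {D E : Type*} (I : Set (Set D)) (J : Set (Set E)) : Set (Set (D × E)) :=
  {A | {d | {e | (d, e) ∈ A} ∉ J} ∈ I}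

/-- `finPowSucc n` is the ideal `Fin^(n+1)` on `ω^(n+1)`: `Fin^1 = Fin` and
`Fin^(n+2) = Fin ⊗ Fin^(n+1)`, where `(i, t) ∈ ω × ω^(n+1)` is identified with the tuple
`Fin.cons i t ∈ ω^(n+2)`. -/
def finPowSucc : (n : ℕ) → Set (Set (Fin (n + 1) → ℕ))
  | 0 => finIdeal (Fin 1 → ℕ)
  | n + 1 => {A | {p : ℕ × (Fin (n + 1) → ℕ) | (Fin.cons p.1 p.2 : Fin (n + 2) → ℕ) ∈ A} ∈
      fubiniProduct (finIdeal ℕ) (finPowSucc n)}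

/-- For every `n`, the sets `X n s`, `s ∈ ω^(n+1)`, form a partition of `ω` into infinite sets, and
any finitely many sets taken from partitions with different `n` have infinite intersection. -/
structure IsIndependentPartitions (X : (n : ℕ) → (Fin (n + 1) → ℕ) → Set ℕ) : Prop where
  infinite : ∀ n s, (X n s).Infinite
  disjoint : ∀ n s t, s ≠ t → Disjoint (X n s) (X n t)
  cover : ∀ n, ⋃ s, X n s = Set.univ
  inter_infinite : ∀ (F : Finset ℕ) (s : (i : ℕ) → Fin (i + 1) → ℕ),
    (⋂ i ∈ F, X i (s i)).Infinite

/-- The copy `Fin^(n+2)({Y s : s ∈ ω^(n+1)})` on `ω` of `Fin^(n+2)`, carried over by a bijection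
`σ : ω^(n+2) → ω` that maps each `{s} × ω` onto `Y s` (all such bijections give the same ideal). -/
def finPowCopy (n : ℕ) (Y : (Fin (n + 1) → ℕ) → Set ℕ) : Set (Set ℕ) :=
  {A | ∃ σ : (Fin (n + 2) → ℕ) ≃ ℕ,
    (∀ s : Fin (n + 1) → ℕ, σ '' {u | ∃ k : ℕ, u = Fin.snoc s k} = Y s) ∧
    σ ⁻¹' A ∈ finPowSucc (n + 1)}

/-- The ideal `Fin'_ω` on `ω` determined by the family of partitions `X`. -/
def finPrimeOmega (X : (n : ℕ) → (Fin (n + 1) → ℕ) → Set ℕ) : Set (Set ℕ) :=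
  generatedIdeal (⋃ n, finPowCopy n (X n))

/-! A copy of Fin^(n+2) consists of the sets meeting `X n s` infinitely only for a Fin^(n+1)-small
set of `s`, so everything is expressed through `infiniteTraceIdeal`.

Upper bound. The ideal is the increasing union of the finite joins `finPrimeStage X N`, so each join
must have finite Borel class. A join is a projection and need not be Borel a priori. The class
`FinGenerated` avoids this: its members are built from Fin in finitely many Borel steps, and it is
closed under joins (`FinGenerated.join`). It contains the copies, so every stage has finite class
and the union is Σ⁰_ω.

Lower bound. If I ⊗ Fin is separated from its dual by a Σ⁰_(k+2) set, then I is separated by a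
Σ⁰_(k+1) set (`SigmaSeparated.of_fubiniProduct`): a Vaught transform averages the separating set, in
the sense of category, over all ways of filling the sections with eventually constant sequences.
Iteration shows that copies of Fin^(n+2) are not Σ⁰_(n+2)-separated. Separation passes to smaller
ideals, so no finite rank is possible.

Independence of the partitions serves only to make the ideal proper. -/

open Set Ordinal

/-! ### Closure properties of the additive Borel classes -/

section Hierarchy

variable {T T' : Type*} [TopologicalSpace T] [TopologicalSpace T'] {α β : Ordinal.{0}}

theorem IsSigma0.eq_one_or_iUnion {S : Set T} (h : IsSigma0 α S) :
    (α = 1 ∧ IsOpen S) ∨ (1 < α ∧ ∃ (A : ℕ → Set T) (β : ℕ → Ordinal.{0}),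
      S = ⋃ n, A n ∧ ∀ n, (1 ≤ β n ∧ β n < α) ∧ IsSigma0 (β n) (A n)ᶜ) := by
  cases h with
  | of_isOpen hU => exact Or.inl ⟨rfl, hU⟩
  | iUnion hα A β hβ hA => exact Or.inr ⟨hα, A, β, rfl, fun n => ⟨hβ n, hA n⟩⟩

theorem IsSigma0.one_le {S : Set T} (h : IsSigma0 α S) : 1 ≤ α := by
  rcases h.eq_one_or_iUnion with h | h
  · exact h.1.ge
  · exact h.1.le

theorem isSigma0_one_iff {S : Set T} : IsSigma0 1 S ↔ IsOpen S := by
  refine ⟨fun h => ?_, IsSigma0.of_isOpen⟩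
  rcases h.eq_one_or_iUnion with h | h
  · exact h.2
  · exact absurd h.1 (lt_irrefl _)

theorem IsSigma0.iUnion_of_compl {ι : Type*} [Countable ι] [Nonempty ι] (hα : 1 < α)
    {A : ι → Set T} (hA : ∀ i, ∃ β < α, IsSigma0 β (A i)ᶜ) : IsSigma0 α (⋃ i, A i) := by
  obtain ⟨e, he⟩ := exists_surjective_nat ι
  choose β hβ hA using hA
  rw [← he.iUnion_comp]
  exact .iUnion hα _ (fun n => β (e n)) (fun n => ⟨(hA _).one_le, hβ _⟩) fun n => hA _

/-- The case α = 1 is excluded because in a general space an open set need not be a countable union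
of closed sets. -/
theorem IsSigma0.mono {S : Set T} (h : IsSigma0 α S) (hα : 1 < α) (hβ : α ≤ β) :
    IsSigma0 β S := by
  rcases h.eq_one_or_iUnion with h | ⟨-, A, γ, rfl, hA⟩
  · exact absurd h.1 hα.ne'
  · exact .iUnion_of_compl (hα.trans_le hβ) fun n => ⟨γ n, (hA n).1.2.trans_le hβ, (hA n).2⟩

theorem IsSigma0.compl {S : Set T} (h : IsSigma0 α S) : IsSigma0 (α + 1) Sᶜ := by
  have hα : α < α + 1 := lt_add_one α
  rw [← iUnion_const (ι := ℕ) Sᶜ]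
  exact .iUnion_of_compl (h.one_le.trans_lt hα) fun _ => ⟨α, hα, by rwa [compl_compl]⟩

theorem IsSigma0.iUnion_of_one_lt {ι : Type*} [Countable ι] [Nonempty ι] (hα : 1 < α)
    {A : ι → Set T} (hA : ∀ i, IsSigma0 α (A i)) : IsSigma0 α (⋃ i, A i) := by
  have h (i : ι) : ∃ (B : ℕ → Set T) (β : ℕ → Ordinal.{0}),
      A i = ⋃ n, B n ∧ ∀ n, (1 ≤ β n ∧ β n < α) ∧ IsSigma0 (β n) (B n)ᶜ := by
    rcases (hA i).eq_one_or_iUnion with h | h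
    · exact absurd h.1 hα.ne'
    · exact h.2
  choose B β hB h using h
  have hU : ⋃ i, A i = ⋃ p : ι × ℕ, B p.1 p.2 := by
    rw [iUnion_prod']
    exact iUnion_congr hB
  rw [hU]
  exact .iUnion_of_compl hα fun p => ⟨β p.1 p.2, (h p.1 p.2).1.2, (h p.1 p.2).2⟩

theorem IsSigma0.iInter {ι : Type*} [Countable ι] [Nonempty ι]
    {A : ι → Set T} (hA : ∀ i, IsSigma0 α (A i)) : IsSigma0 (α + 1 + 1) (⋂ i, A i) := by
  have hα : α < α + 1 := lt_add_one α
  rw [iInter_eq_compl_iUnion_compl]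
  exact IsSigma0.compl <| .iUnion_of_compl (((hA (Classical.arbitrary ι)).one_le).trans_lt hα)
    fun i => ⟨α, hα, by simpa using hA i⟩

theorem IsSigma0.preimage {S : Set T} (h : IsSigma0 α S) {f : T' → T} (hf : Continuous f) :
    IsSigma0 α (f ⁻¹' S) := by
  induction h with
  | of_isOpen hU => exact .of_isOpen (hU.preimage hf)
  | iUnion hα A β hβ hA ih =>
    rw [preimage_iUnion]
    exact .iUnion hα _ β hβ ih

theorem IsSigma0.measurableSet [MeasurableSpace T] [BorelSpace T] {S : Set T}
    (h : IsSigma0 α S) : MeasurableSet S := by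
  induction h with
  | of_isOpen hU => exact hU.measurableSet
  | iUnion hα A β hβ hA ih => exact .iUnion fun n => (ih n).of_compl

theorem isSigma0Family_finIdeal (D : Type*) [Countable D] : IsSigma0Family 2 (finIdeal D) := by
  have h : {x : D → Bool | {d | x d = true} ∈ finIdeal D} =
      ⋃ F : Finset D, {x : D → Bool | ∀ d ∉ F, x d = false} := by
    ext x
    simp only [finIdeal, mem_ofPred_eq, mem_iUnion]
    constructor
    · intro hx
      exact ⟨hx.toFinset, fun d hd => by simpa using hd⟩
    · rintro ⟨F, hF⟩
      refine F.finite_toSet.subset fun d hd => ?_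
      by_contra hdF
      simp [hF d hdF] at hd
  unfold IsSigma0Family
  rw [h]
  refine .iUnion_of_compl one_lt_two fun F => ⟨1, one_lt_two, .of_isOpen ?_⟩
  rw [isOpen_compl_iff]
  simp only [ofPred_forall]
  exact isClosed_iInter fun d => isClosed_iInter fun _ =>
    isClosed_eq (continuous_apply d) continuous_const

end Hierarchy

/-! ### Ideals built from Fin in finitely many steps, and their joins -/

section Join

variable {D : Type*}

/-- The family of all unions of a member of `I` and a member of `J`. -/
def joinFamily (I J : Set (Set D)) : Set (Set D) :=
  {A | ∃ B ∈ I, ∃ C ∈ J, A = B ∪ C}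

/-- The ideals obtained from the ideal of finite sets in `k` steps, a step being either an
increasing union or the passage to the ideal of all sets whose traces on given sets `B x` are in
given ideals `I x`. -/
inductive FinGenerated : ℕ → Set (Set D) → Prop
  | fin : FinGenerated 0 (finIdeal D)
  | iUnion {k : ℕ} {I : ℕ → Set (Set D)} (hI : ∀ m, FinGenerated k (I m)) (hmono : Monotone I) :
      FinGenerated (k + 1) (⋃ m, I m)
  | traces {k : ℕ} {I : ℕ → Set (Set D)} {B : ℕ → Set D} (hI : ∀ x, FinGenerated k (I x))
      (hB : ∀ x, ∀ A ∈ I x, A ⊆ B x → ∀ y, A ∩ B y ∈ I y) :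
      FinGenerated (k + 1) {A | ∀ x, A ∩ B x ∈ I x}

namespace FinGenerated

variable {k l : ℕ} {I J : Set (Set D)} {A B : Set D}

theorem subset_mem (h : FinGenerated k I) (hAB : A ⊆ B) (hB : B ∈ I) : A ∈ I := by
  induction h generalizing A B with
  | fin => exact Finite.subset hB hAB
  | iUnion hI hmono ih =>
    obtain ⟨m, hm⟩ := mem_iUnion.1 hB
    exact mem_iUnion.2 ⟨m, ih m hAB hm⟩
  | traces hI hB' ih => exact fun x => ih x (inter_subset_inter_left _ hAB) (hB x)

theorem union_mem (h : FinGenerated k I) (hA : A ∈ I) (hB : B ∈ I) : A ∪ B ∈ I := by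
  induction h generalizing A B with
  | fin => exact Finite.union hA hB
  | iUnion hI hmono ih =>
    obtain ⟨m, hm⟩ := mem_iUnion.1 hA
    obtain ⟨n, hn⟩ := mem_iUnion.1 hB
    exact mem_iUnion.2 ⟨max m n, ih _ (hmono (le_max_left m n) hm) (hmono (le_max_right m n) hn)⟩
  | traces hI hB' ih =>
    intro x
    rw [union_inter_distrib_right]
    exact ih x (hA x) (hB x)

theorem finite_mem (h : FinGenerated k I) (hA : A.Finite) : A ∈ I := by
  induction h generalizing A with
  | fin => exact hA
  | iUnion hI hmono ih => exact mem_iUnion.2 ⟨0, ih 0 hA⟩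
  | traces hI hB' ih => exact fun x => ih x (hA.subset inter_subset_left)

theorem biUnion_mem (h : FinGenerated k I) {C : ℕ → Set D} (hC : ∀ z, C z ∈ I) (n : ℕ) :
    ⋃ z ≤ n, C z ∈ I := by
  induction n with
  | zero => simpa using hC 0
  | succ n ih =>
    rw [biUnion_le_succ]
    exact h.union_mem ih (hC _)

theorem joinFamily_comm (I J : Set (Set D)) : joinFamily I J = joinFamily J I := by
  ext A
  constructor <;> rintro ⟨B, hB, C, hC, rfl⟩ <;> exact ⟨C, hC, B, hB, union_comm _ _⟩

theorem joinFamily_finIdeal (h : FinGenerated k I) : joinFamily I (finIdeal D) = I := by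
  ext A
  constructor
  · rintro ⟨B, hB, C, hC, rfl⟩
    exact h.union_mem hB (h.finite_mem hC)
  · exact fun hA => ⟨A, hA, ∅, finite_empty, (union_empty A).symm⟩

theorem joinFamily_iUnion (I : ℕ → Set (Set D)) (J : Set (Set D)) :
    joinFamily (⋃ m, I m) J = ⋃ m, joinFamily (I m) J := by
  ext A
  simp only [joinFamily, mem_iUnion, mem_ofPred_eq]
  constructor
  · rintro ⟨B, ⟨m, hm⟩, C, hC, rfl⟩
    exact ⟨m, B, hm, C, hC, rfl⟩
  · rintro ⟨m, B, hm, C, hC, rfl⟩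
    exact ⟨B, ⟨m, hm⟩, C, hC, rfl⟩

theorem joinFamily_mono {I I' J J' : Set (Set D)} (h : I ⊆ I') (h' : J ⊆ J') :
    joinFamily I J ⊆ joinFamily I' J' := by
  rintro _ ⟨B, hB, C, hC, rfl⟩
  exact ⟨B, h hB, C, h' hC, rfl⟩

/-- If all traces of `A` on the sets `B z` are unions of a member of `I` and a member of `J`, then
`A` is the union of two sets with traces in `I` and in `J`. -/
theorem exists_union_of_traces (hI : FinGenerated k I) (hJ : FinGenerated l J) (B : ℕ → Set D)
    (hA : ∀ z, A ∩ B z ∈ joinFamily I J) :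
    ∃ A₀ A₁, A = A₀ ∪ A₁ ∧ (∀ z, A₀ ∩ B z ∈ I) ∧ ∀ z, A₁ ∩ B z ∈ J := by
  choose C hC E hE hCE using hA
  -- Each point is sorted at the first `z` with `a ∈ B z`, according to the splitting `C z ∪ E z`
  -- there; points in no `B z` go to the first set. In `B z` the first index is at most `z`, so
  -- finitely many `C w` or `E w` cover the trace.
  refine ⟨{a ∈ A | ∀ z, a ∈ B z → (∀ w < z, a ∉ B w) → a ∈ C z},
    {a ∈ A | ∃ z, a ∈ E z ∧ ∀ w < z, a ∉ B w}, ?_, fun z => ?_, fun z => ?_⟩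
  · ext a
    constructor
    · intro ha
      by_cases h : ∀ z, a ∈ B z → (∀ w < z, a ∉ B w) → a ∈ C z
      · exact Or.inl ⟨ha, h⟩
      · push Not at h
        obtain ⟨z, hz, hw, hCz⟩ := h
        have : a ∈ C z ∪ E z := hCE z ▸ ⟨ha, hz⟩
        exact Or.inr ⟨ha, z, this.resolve_left hCz, hw⟩
    · rintro (h | h) <;> exact h.1
  · refine hI.subset_mem ?_ (hI.biUnion_mem hC z)
    rintro a ⟨⟨-, ha⟩, haz⟩
    classical
    have hex : ∃ z, a ∈ B z := ⟨z, haz⟩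
    exact mem_biUnion (Nat.find_min' hex haz)
      (ha _ (Nat.find_spec hex) fun w hw => Nat.find_min hex hw)
  · refine hJ.subset_mem ?_ (hJ.biUnion_mem hE z)
    rintro a ⟨⟨-, w, ha, hw⟩, haz⟩
    exact mem_biUnion (not_lt.1 fun hlt => hw z hlt haz) ha

/-- This is the role of the compatibility condition in `FinGenerated.traces`: a local member, cut
down to its set `B x`, is a member of the global ideal. -/
theorem inter_mem_traces {I : ℕ → Set (Set D)} {B : ℕ → Set D}
    (hB : ∀ x, ∀ A ∈ I x, A ⊆ B x → ∀ y, A ∩ B y ∈ I y) {x : ℕ} (hI : FinGenerated k (I x))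
    (hA : A ∈ I x) : A ∩ B x ∈ {A | ∀ x, A ∩ B x ∈ I x} :=
  hB x _ (hI.subset_mem inter_subset_left hA) inter_subset_right

/-- With P and Q the two trace ideals, their join is itself a trace ideal, over both families of
sets together: the local ideal is I x ∨ Q on `B x` and P ∨ J x on `E x`. Local splittings are glued
by `exists_union_of_traces`. -/
theorem traces_joinFamily_traces {I J : ℕ → Set (Set D)} {B E : ℕ → Set D}
    (hI : ∀ x, FinGenerated k (I x)) (hB : ∀ x, ∀ A ∈ I x, A ⊆ B x → ∀ y, A ∩ B y ∈ I y)
    (hJ : ∀ x, FinGenerated l (J x)) (hE : ∀ x, ∀ A ∈ J x, A ⊆ E x → ∀ y, A ∩ E y ∈ J y)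
    {m : ℕ} (h₁ : ∀ x, FinGenerated m (joinFamily (I x) {A | ∀ x, A ∩ E x ∈ J x}))
    (h₂ : ∀ x, FinGenerated m (joinFamily {A | ∀ x, A ∩ B x ∈ I x} (J x))) :
    FinGenerated (m + 1) (joinFamily {A | ∀ x, A ∩ B x ∈ I x} {A | ∀ x, A ∩ E x ∈ J x}) := by
  set P : Set (Set D) := {A | ∀ x, A ∩ B x ∈ I x}
  set Q : Set (Set D) := {A | ∀ x, A ∩ E x ∈ J x}
  have hPk : FinGenerated (k + 1) P := .traces hI hB
  have hQl : FinGenerated (l + 1) Q := .traces hJ hE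
  let e : ℕ ≃ ℕ ⊕ ℕ := Equiv.natSumNatEquivNat.symm
  let F : ℕ ⊕ ℕ → Set D := Sum.elim B E
  let K : ℕ ⊕ ℕ → Set (Set D) := Sum.elim (fun x => joinFamily (I x) Q) fun x => joinFamily P (J x)
  have hK (z) : FinGenerated m (K z) := by cases z <;> simp [K, h₁, h₂]
  have hKF (z) (A : Set D) (hA : A ∈ K z) (hAF : A ⊆ F z) : A ∈ joinFamily P Q := by
    rcases z with x | x
    · obtain ⟨C, hC, C', hC', rfl⟩ := hA
      have hAF : C ∪ C' ⊆ B x := hAF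
      have := inter_mem_traces hB (hI x) hC
      rw [inter_eq_left.2 (subset_union_left.trans hAF)] at this
      exact ⟨C, this, C', hC', rfl⟩
    · obtain ⟨C, hC, C', hC', rfl⟩ := hA
      have hAF : C ∪ C' ⊆ E x := hAF
      have := inter_mem_traces hE (hJ x) hC'
      rw [inter_eq_left.2 (subset_union_right.trans hAF)] at this
      exact ⟨C, hC, C', this, rfl⟩
  have hFK (z) (A : Set D) (hA : A ∈ joinFamily P Q) : A ∩ F z ∈ K z := by
    obtain ⟨C, hC, C', hC', rfl⟩ := hA
    rw [union_inter_distrib_right]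
    rcases z with x | x
    · exact ⟨_, hC x, _, hQl.subset_mem inter_subset_left hC', rfl⟩
    · exact ⟨_, hPk.subset_mem inter_subset_left hC, _, hC' x, rfl⟩
  have heq : joinFamily P Q = {A | ∀ z, A ∩ F (e z) ∈ K (e z)} := by
    ext A
    refine ⟨fun hA z => hFK _ A hA, fun hA => ?_⟩
    obtain ⟨A₀, A₁, rfl, h₀, h₁⟩ := exists_union_of_traces hPk hQl (fun z => F (e z))
      fun z => hKF _ _ (hA z) inter_subset_right
    refine ⟨A₀, fun x => ?_, A₁, fun x => ?_, rfl⟩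
    · have := h₀ (e.symm (.inl x)) x
      simpa [F, inter_assoc] using this
    · have := h₁ (e.symm (.inr x)) x
      simpa [F, inter_assoc] using this
  rw [heq]
  exact .traces (fun z => hK _) fun z A hA hAF w => hFK _ _ (hKF _ _ hA hAF)

/-- Double induction: when both ideals are trace ideals, the local ideals are joins in which just
one of the two has been replaced by a simpler one. -/
theorem join (hI : FinGenerated k I) (hJ : FinGenerated l J) :
    FinGenerated (k + l) (joinFamily I J) := by
  induction hI generalizing l J with
  | fin => rwa [joinFamily_comm, hJ.joinFamily_finIdeal, zero_add]
  | @iUnion k I hI hmono ih =>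
    rw [joinFamily_iUnion, add_right_comm]
    exact .iUnion (fun m => ih m hJ) fun m n hmn => joinFamily_mono (hmono hmn) subset_rfl
  | @traces k I B hI hB ih =>
    induction hJ with
    | fin => rw [joinFamily_finIdeal (.traces hI hB)]; exact .traces hI hB
    | @iUnion l J hJ hmono ihJ =>
      rw [joinFamily_comm, joinFamily_iUnion]
      refine .iUnion (fun m => ?_) fun m n hmn => joinFamily_mono (hmono hmn) subset_rfl
      rw [joinFamily_comm]
      exact ihJ m
    | @traces l J E hJ hE ihJ =>
      refine traces_joinFamily_traces hI hB hJ hE (fun x => ?_) ihJ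
      have := ih x (.traces hJ hE)
      rwa [show k + (l + 1) = k + 1 + l by ring] at this

/-- Fin is Σ⁰_2 and each step costs at most two classes; forming traces is a countable intersection
of continuous preimages. -/
theorem isSigma0Family [Countable D] (h : FinGenerated k I) :
    IsSigma0Family ((2 * k + 2 : ℕ) : Ordinal.{0}) I := by
  induction h with
  | fin => simpa using isSigma0Family_finIdeal D
  | @iUnion k I hI hmono ih =>
    have : {x : D → Bool | {d | x d = true} ∈ ⋃ m, I m} =
        ⋃ m, {x : D → Bool | {d | x d = true} ∈ I m} := by
      ext x
      simp
    unfold IsSigma0Family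
    rw [this]
    refine (IsSigma0.iUnion_of_one_lt ?_ ih).mono ?_ ?_ <;> norm_cast <;> omega
  | @traces k I B hI hB ih =>
    classical
    have : {x : D → Bool | {d | x d = true} ∈ {A | ∀ y, A ∩ B y ∈ I y}} =
        ⋂ y, (fun (x : D → Bool) d => x d && decide (d ∈ B y)) ⁻¹'
          {x : D → Bool | {d | x d = true} ∈ I y} := by
      ext x
      simp only [mem_ofPred_eq, mem_iInter, mem_preimage, Bool.and_eq_true, decide_eq_true_eq]
      rfl
    unfold IsSigma0Family
    rw [this]
    have hc (y : ℕ) : Continuous fun (x : D → Bool) d => x d && decide (d ∈ B y) :=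
      continuous_pi fun d => (continuous_of_discreteTopology (f := fun b => b && decide (d ∈ B y))).comp
        (continuous_apply d)
    have := IsSigma0.iInter fun y => (ih y).preimage (hc y)
    rwa [show (((2 * (k + 1) + 2 : ℕ) : Ordinal.{0})) = ((2 * k + 2 : ℕ) : Ordinal.{0}) + 1 + 1 by
      norm_cast]

/-- "For all but finitely many x" is an increasing union over `m` of "for all x ≥ m", hence one
trace step and one union step. The sets tested at x < m are empty. -/
theorem cofinite_fibers (h : FinGenerated k I) (c : D → ℕ) :
    FinGenerated (k + 2) {A | {x | A ∩ c ⁻¹' {x} ∉ I}.Finite} := by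
  have heq : {A | {x | A ∩ c ⁻¹' {x} ∉ I}.Finite} =
      ⋃ m, {A | ∀ x, A ∩ {a | c a = x ∧ m ≤ x} ∈ I} := by
    ext A
    simp only [mem_ofPred_eq, mem_iUnion]
    constructor
    · intro hA
      obtain ⟨m, hm⟩ := hA.bddAbove
      refine ⟨m + 1, fun x => ?_⟩
      by_cases hx : m + 1 ≤ x
      · by_contra hc
        have hsub : A ∩ {a | c a = x ∧ m + 1 ≤ x} ⊆ A ∩ c ⁻¹' {x} :=
          fun a ha => ⟨ha.1, ha.2.1⟩
        have := hm (show x ∈ {x | A ∩ c ⁻¹' {x} ∉ I} from fun h' => hc (h.subset_mem hsub h'))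
        omega
      · exact h.finite_mem (finite_empty.subset fun a ha => hx ha.2.2)
    · rintro ⟨m, hm⟩
      refine (finite_lt_nat m).subset fun x hx => ?_
      by_contra hmx
      have hsub : A ∩ c ⁻¹' {x} ⊆ A ∩ {a | c a = x ∧ m ≤ x} :=
        fun a ha => ⟨ha.1, ha.2, not_lt.1 hmx⟩
      exact hx (h.subset_mem hsub (hm x))
  rw [heq]
  refine .iUnion (fun m => .traces (fun _ => h) fun x A hA _ y => h.subset_mem inter_subset_left hA)
    fun m n hmn A hA x => ?_
  have hsub : A ∩ {a | c a = x ∧ n ≤ x} ⊆ A ∩ {a | c a = x ∧ m ≤ x} :=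
    fun a ha => ⟨ha.1, ha.2.1, hmn.trans ha.2.2⟩
  exact h.subset_mem hsub (hA x)

end FinGenerated

end Join

/-! ### Vaught transforms and the drop of Borel class -/

section Vaught

variable {ι : Type*}

/-- The subset of `ι × ℕ` whose `s`-th section starts with the finite pattern coded by `x s` and
is constantly `l s` after it. -/
def patternFill (l : ι → Bool) (x : ι → ℕ) : ι × ℕ → Bool := fun p =>
  ((Encodable.decode (α := List Bool) (x p.1)).getD []).getD p.2 (l p.1)

/-- The basic open subset of `ι → ℕ` given by a finite partial function. -/
def finCylinder (V : Σ F : Finset ι, F → ℕ) : Set (ι → ℕ) := {x | ∀ s : V.1, x s = V.2 s}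

theorem isOpen_finCylinder (V : Σ F : Finset ι, F → ℕ) : IsOpen (finCylinder V) := by
  simp only [finCylinder, ofPred_forall]
  exact isOpen_iInter_of_finite fun s =>
    show IsOpen ((fun x : ι → ℕ => x s) ⁻¹' {V.2 s}) from
      (isOpen_discrete _).preimage (continuous_apply (s : ι))

theorem finCylinder_nonempty (V : Σ F : Finset ι, F → ℕ) : (finCylinder V).Nonempty := by
  classical
  exact ⟨fun s => if h : s ∈ V.1 then V.2 ⟨s, h⟩ else 0, fun s => by simp⟩

theorem exists_finCylinder_subset {U : Set (ι → ℕ)} (hU : IsOpen U) {x : ι → ℕ} (hx : x ∈ U) :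
    ∃ V : Σ F : Finset ι, F → ℕ, finCylinder V ⊆ U := by
  obtain ⟨F, u, hu, hF⟩ := isOpen_pi_iff.1 hU x hx
  refine ⟨⟨F, fun s => x s⟩, fun y hy => hF fun s hs => ?_⟩
  have : y s = x s := hy ⟨s, hs⟩
  rw [this]
  exact (hu s hs).2

theorem not_isMeagre_finCylinder [Countable ι] (V : Σ F : Finset ι, F → ℕ) :
    ¬ IsMeagre (finCylinder V) :=
  not_isMeagre_of_isOpen (isOpen_finCylinder V) (finCylinder_nonempty V)

/-- By the Baire property, `N` is open modulo a meagre set; the converse holds because cylinders are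
nonmeagre by the Baire category theorem. -/
theorem not_isMeagre_finCylinder_inter_iff [Countable ι] (V : Σ F : Finset ι, F → ℕ)
    {N : Set (ι → ℕ)} (hN : BaireMeasurableSet N) :
    ¬ IsMeagre (finCylinder V ∩ N) ↔
      ∃ W, finCylinder W ⊆ finCylinder V ∧ IsMeagre (finCylinder W ∩ Nᶜ) := by
  constructor
  · intro h
    obtain ⟨U, hU, hNU⟩ := hN.residualEq_isOpen
    have hdiff : IsMeagre {x | ¬ (x ∈ N ↔ x ∈ U)} := by
      rw [IsMeagre]
      filter_upwards [Filter.eventuallyEq_set.1 hNU] with x hx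
      simpa using hx
    have hne : (finCylinder V ∩ U).Nonempty := by
      by_contra hemp
      have hsub : finCylinder V ∩ N ⊆ {x | ¬ (x ∈ N ↔ x ∈ U)} :=
        fun x hx hiff => hemp ⟨x, hx.1, hiff.1 hx.2⟩
      exact h (hdiff.mono hsub)
    obtain ⟨x, hx⟩ := hne
    obtain ⟨W, hW⟩ := exists_finCylinder_subset ((isOpen_finCylinder V).inter hU) hx
    have hsub : finCylinder W ∩ Nᶜ ⊆ {x | ¬ (x ∈ N ↔ x ∈ U)} :=
      fun y hy hiff => hy.2 (hiff.2 (hW hy.1).2)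
    exact ⟨W, hW.trans inter_subset_left, hdiff.mono hsub⟩
  · rintro ⟨W, hWV, hW⟩ h
    refine not_isMeagre_finCylinder W ((h.union hW).mono fun x hx => ?_)
    by_cases hxN : x ∈ N
    · exact Or.inl ⟨hWV hx, hxN⟩
    · exact Or.inr ⟨hx, hxN⟩

/-- The Vaught transform of `S` along `patternFill`, localized to a basic open set. -/
def vaughtTransform (V : Σ F : Finset ι, F → ℕ) (S : Set (ι × ℕ → Bool)) : Set (ι → Bool) :=
  {l | ¬ IsMeagre (finCylinder V ∩ patternFill l ⁻¹' S)}

theorem continuous_patternFill (l : ι → Bool) : Continuous (patternFill l) :=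
  continuous_pi fun p => (continuous_of_discreteTopology
    (f := fun n : ℕ => ((Encodable.decode (α := List Bool) n).getD []).getD p.2 (l p.1))).comp
      (continuous_apply p.1)

theorem vaughtTransform_iUnion (V : Σ F : Finset ι, F → ℕ) (A : ℕ → Set (ι × ℕ → Bool)) :
    vaughtTransform V (⋃ n, A n) = ⋃ n, vaughtTransform V (A n) := by
  ext l
  simp only [vaughtTransform, preimage_iUnion, inter_iUnion, mem_ofPred_eq, mem_iUnion]
  constructor
  · intro h
    by_contra! hc
    exact h (isMeagre_iUnion hc)
  · rintro ⟨n, hn⟩ h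
    exact hn (h.mono (subset_iUnion (fun n => finCylinder V ∩ patternFill l ⁻¹' A n) n))

theorem vaughtTransform_eq_iUnion_compl [Countable ι] (V : Σ F : Finset ι, F → ℕ)
    {A : Set (ι × ℕ → Bool)} {α : Ordinal.{0}} (hA : IsSigma0 α Aᶜ) :
    vaughtTransform V A =
      ⋃ W : {W // finCylinder W ⊆ finCylinder V}, (vaughtTransform W.1 Aᶜ)ᶜ := by
  ext l
  have hm : BaireMeasurableSet (patternFill l ⁻¹' A) := by
    borelize (ι → ℕ)
    refine MeasurableSet.baireMeasurableSet ?_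
    exact MeasurableSet.of_compl (hA.preimage (continuous_patternFill l)).measurableSet
  simp [vaughtTransform, not_isMeagre_finCylinder_inter_iff V hm]

/-- Off the finite set `V.1` the pattern is free, so `y` can code the first `k` values outright and
the tail value `l'` does not show before position `k`. -/
theorem exists_patternFill_eq {V : Σ F : Finset ι, F → ℕ} {l l' : ι → Bool}
    (hl : ∀ s ∈ V.1, l s = l' s) {x : ι → ℕ} (hx : x ∈ finCylinder V) (k : ℕ) :
    ∃ y ∈ finCylinder V, ∀ s, ∀ j < k, patternFill l' y (s, j) = patternFill l x (s, j) := by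
  classical
  refine ⟨fun s => if s ∈ V.1 then x s else
    Encodable.encode (List.ofFn fun j : Fin k => patternFill l x (s, j)), fun s => ?_,
    fun s j hj => ?_⟩
  · simpa using hx s
  · by_cases hs : s ∈ V.1
    · simp [patternFill, hs, hl s hs]
    · simp [patternFill, hs, hj]

theorem mem_vaughtTransform_of_isOpen_iff [Countable ι] {V : Σ F : Finset ι, F → ℕ}
    {U : Set (ι × ℕ → Bool)} (hU : IsOpen U) {l : ι → Bool} :
    l ∈ vaughtTransform V U ↔ ∃ x ∈ finCylinder V, patternFill l x ∈ U := by
  constructor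
  · intro h
    by_contra hc
    refine h (IsMeagre.empty.mono ?_)
    exact fun x hx => hc ⟨x, hx.1, hx.2⟩
  · rintro ⟨x, hx, hxU⟩
    exact not_isMeagre_of_isOpen
      ((isOpen_finCylinder V).inter (hU.preimage (continuous_patternFill l))) ⟨x, hx, hxU⟩

theorem mem_vaughtTransform_of_eqOn [Countable ι] {V : Σ F : Finset ι, F → ℕ}
    {U : Set (ι × ℕ → Bool)} (hU : IsOpen U) {l l' : ι → Bool}
    (hl : ∀ s ∈ V.1, l s = l' s) (h : l ∈ vaughtTransform V U) : l' ∈ vaughtTransform V U := by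
  rw [mem_vaughtTransform_of_isOpen_iff hU] at h ⊢
  obtain ⟨x, hx, hxU⟩ := h
  obtain ⟨G, u, hu, hG⟩ := isOpen_pi_iff.1 hU _ hxU
  obtain ⟨y, hy, hyx⟩ := exists_patternFill_eq hl hx (G.sup Prod.snd + 1)
  refine ⟨y, hy, hG fun p hp => ?_⟩
  rw [hyx p.1 p.2 (Nat.lt_succ_of_le (Finset.le_sup (f := Prod.snd) hp))]
  exact (hu p hp).2

/-- Membership depends only on the values of `l` on the finite set `V.1`. Open sets thus become
clopen, which is where one Borel class is gained. -/
theorem isClopen_vaughtTransform [Countable ι] (V : Σ F : Finset ι, F → ℕ)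
    {U : Set (ι × ℕ → Bool)} (hU : IsOpen U) : IsClopen (vaughtTransform V U) := by
  have h : vaughtTransform V U =
      (fun (l : ι → Bool) (s : V.1) => l s) ⁻¹' ((fun l s => l s) '' vaughtTransform V U) := by
    refine (subset_preimage_image _ _).antisymm ?_
    rintro l ⟨l', hl', heq⟩
    exact mem_vaughtTransform_of_eqOn hU (fun s hs => congrFun heq ⟨s, hs⟩) hl'
  rw [h]
  exact (isClopen_discrete _).preimage (continuous_pi fun s => continuous_apply _)

/-- Transforms commute with countable unions and turn complements into countable unions of
complements of transforms. At the bottom, a countable union of closed sets yields a union of clopen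
sets, hence an open set; the gain then propagates upwards. -/
theorem isSigma0_vaughtTransform [Countable ι] (k : ℕ) (V : Σ F : Finset ι, F → ℕ)
    {S : Set (ι × ℕ → Bool)} (hS : IsSigma0 ((k + 2 : ℕ) : Ordinal.{0}) S) :
    IsSigma0 ((k + 1 : ℕ) : Ordinal.{0}) (vaughtTransform V S) := by
  induction k using Nat.strong_induction_on generalizing V S with
  | _ k ih =>
  rcases hS.eq_one_or_iUnion with ⟨h, -⟩ | ⟨-, A, β, rfl, hA⟩
  · norm_cast at h
    omega
  have hW (n : ℕ) (W : Σ F : Finset ι, F → ℕ) : IsClopen (vaughtTransform W (A n)ᶜ) ∨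
      ∃ j < k, IsSigma0 ((j + 1 : ℕ) : Ordinal.{0}) (vaughtTransform W (A n)ᶜ) := by
    obtain ⟨⟨h1, hlt⟩, hAn⟩ := hA n
    obtain ⟨b, hb⟩ := lt_omega0.1 (hlt.trans (natCast_lt_omega0 _))
    rw [hb] at h1 hlt hAn
    norm_cast at h1 hlt
    obtain rfl | ⟨j, rfl⟩ : b = 1 ∨ ∃ j, b = j + 2 := by
      rcases h1.eq_or_lt with h | h
      · exact Or.inl h.symm
      · exact Or.inr ⟨b - 2, by omega⟩
    · rw [Nat.cast_one, isSigma0_one_iff] at hAn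
      exact Or.inl (isClopen_vaughtTransform W hAn)
    · exact Or.inr ⟨j, by omega, ih j (by omega) W hAn⟩
  have hne (V : Σ F : Finset ι, F → ℕ) : Nonempty {W // finCylinder W ⊆ finCylinder V} :=
    ⟨⟨V, subset_rfl⟩⟩
  rw [vaughtTransform_iUnion]
  simp_rw [fun n => vaughtTransform_eq_iUnion_compl V (hA n).2]
  rcases k with _ | k
  · rw [zero_add, Nat.cast_one, isSigma0_one_iff]
    refine isOpen_iUnion fun n => isOpen_iUnion fun W => ?_
    rcases hW n W with h | ⟨j, hj, -⟩
    · exact h.compl.isOpen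
    · omega
  · have hk : (1 : Ordinal.{0}) < ((k + 1 + 1 : ℕ) : Ordinal.{0}) := by norm_cast; omega
    refine .iUnion_of_one_lt hk fun n => .iUnion_of_compl hk fun W => ?_
    rw [compl_compl]
    rcases hW n W with h | ⟨j, hj, h⟩
    · exact ⟨1, hk, .of_isOpen h.isOpen⟩
    · exact ⟨_, by norm_cast; omega, h⟩

end Vaught

/-! ### Separation of an ideal from its dual -/

section Separation

/-- `I` and its dual family are separated by a `Σ⁰_α` family. -/
def SigmaSeparated {D : Type*} (α : Ordinal.{0}) (I : Set (Set D)) : Prop :=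
  ∃ S : Set (Set D), IsSigma0Family α S ∧ I ⊆ S ∧ dualFamily I ∩ S = ∅

variable {D E ι : Type*} {α : Ordinal.{0}}

theorem SigmaSeparated.anti {I J : Set (Set D)} (h : SigmaSeparated α J) (hIJ : I ⊆ J) :
    SigmaSeparated α I := by
  obtain ⟨S, hS, hJS, hd⟩ := h
  refine ⟨S, hS, hIJ.trans hJS, eq_empty_of_forall_notMem ?_⟩
  rintro _ ⟨⟨A, hA, rfl⟩, hAS⟩
  exact (eq_empty_iff_forall_notMem.1 hd) _ ⟨⟨A, hIJ hA, rfl⟩, hAS⟩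

theorem SigmaSeparated.preimage {I : Set (Set D)} {J : Set (Set E)} (h : SigmaSeparated α I)
    (e : D ≃ E) (heq : ∀ A, A ∈ J ↔ e ⁻¹' A ∈ I) : SigmaSeparated α J := by
  obtain ⟨S, hS, hIS, hd⟩ := h
  refine ⟨{A | e ⁻¹' A ∈ S}, ?_, fun A hA => hIS ((heq A).1 hA), eq_empty_of_forall_notMem ?_⟩
  · exact IsSigma0.preimage hS (f := fun (x : E → Bool) d => x (e d))
      (continuous_pi fun d => continuous_apply _)
  · rintro _ ⟨⟨A, hA, rfl⟩, hAS⟩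
    exact (eq_empty_iff_forall_notMem.1 hd) _ ⟨⟨_, (heq A).1 hA, rfl⟩, hAS⟩

/-- The section of `patternFill l x` at `s` is eventually `l s`, so for every `x` the filled set
lies in I ⊗ Fin or its dual whenever `l` codes a member of I or its dual. The separating set then
contains all the fillings or none, and its transform separates I. -/
theorem SigmaSeparated.of_fubiniProduct [Countable ι] {I : Set (Set ι)} {k : ℕ}
    (h : SigmaSeparated ((k + 2 : ℕ) : Ordinal.{0}) (fubiniProduct I (finIdeal ℕ))) :
    SigmaSeparated ((k + 1 : ℕ) : Ordinal.{0}) I := by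
  obtain ⟨S, hS, hIS, hd⟩ := h
  -- The empty condition, whose cylinder is the whole space.
  let V : Σ F : Finset ι, F → ℕ := ⟨∅, fun _ => 0⟩
  let S' : Set (ι × ℕ → Bool) := {x | {d | x d = true} ∈ S}
  let p (x : ι → ℕ) (s : ι) : List Bool := (Encodable.decode (x s)).getD []
  have hlt (l : ι → Bool) (x : ι → ℕ) (s : ι) (j : ℕ) (hj : (p x s).length ≤ j) :
      patternFill l x (s, j) = l s := by
    change (p x s).getD j (l s) = l s
    simp [hj]
  have hfin (l : ι → Bool) (x : ι → ℕ) (s : ι) (b : Bool) (hl : l s ≠ b) :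
      {j | patternFill l x (s, j) = b}.Finite := by
    refine (finite_lt_nat (p x s).length).subset fun j hj => ?_
    by_contra hc
    exact hl ((hlt l x s j (not_lt.1 hc)).symm.trans hj)
  have hiff (l : ι → Bool) (x : ι → ℕ) (s : ι) (b : Bool) :
      {j | patternFill l x (s, j) = b} ∉ finIdeal ℕ ↔ l s = b := by
    refine ⟨fun h => by_contra fun hc => h (hfin l x s b hc), fun h hf => ?_⟩
    have := hfin l x s (!b) (by simp [h])
    refine infinite_univ ((hf.union this).subset fun j _ => ?_)
    cases h : patternFill l x (s, j) <;> cases b <;> simp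
  have hmem (l : ι → Bool) (x : ι → ℕ) (b : Bool) :
      {d | patternFill l x d = b} ∈ fubiniProduct I (finIdeal ℕ) ↔ {s | l s = b} ∈ I := by
    have : {s | {j | patternFill l x (s, j) = b} ∉ finIdeal ℕ} = {s | l s = b} := by
      ext s
      exact hiff l x s b
    change {s | {j | patternFill l x (s, j) = b} ∉ finIdeal ℕ} ∈ I ↔ _
    rw [this]
  classical
  refine ⟨{A | (fun s => decide (s ∈ A)) ∈ vaughtTransform V S'}, ?_, ?_, ?_⟩
  · have := isSigma0_vaughtTransform k V hS
    rw [IsSigma0Family]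
    convert this using 1
    ext x
    simp [S']
  · intro A hA hm
    have hsub : finCylinder V ⊆ finCylinder V ∩ patternFill (fun s => decide (s ∈ A)) ⁻¹' S' :=
      fun x hx => ⟨hx, hIS ((hmem _ x true).2 (by simpa using hA))⟩
    exact not_isMeagre_finCylinder V (hm.mono hsub)
  · refine eq_empty_of_forall_notMem ?_
    rintro _ ⟨⟨A, hA, rfl⟩, hm⟩
    refine hm (IsMeagre.empty.mono ?_)
    rintro x ⟨-, hx⟩
    refine (eq_empty_iff_forall_notMem.1 hd) _ ⟨⟨_, (hmem (fun s => decide (s ∈ Aᶜ)) x false).2 ?_, ?_⟩, hx⟩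
    · simpa using hA
    · ext d
      simp

/-- A neighbourhood of ∅ restricts only finitely many coordinates, so it contains a cofinite set. -/
theorem not_sigmaSeparated_one {I : Set (Set D)} (hI : IsIdealOn I) : ¬ SigmaSeparated 1 I := by
  rintro ⟨S, hS, hIS, hd⟩
  rw [IsSigma0Family, isSigma0_one_iff] at hS
  have hempty : (fun _ => false : D → Bool) ∈ {x : D → Bool | {d | x d = true} ∈ S} :=
    hIS (hI.finite_mem (by simp))
  obtain ⟨F, u, hu, hF⟩ := isOpen_pi_iff.1 hS _ hempty
  classical
  have h := hF (show (fun d => decide (d ∉ F)) ∈ (F : Set D).pi u from fun d hd => by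
    simpa [Finset.mem_coe.1 hd] using (hu d hd).2)
  refine (eq_empty_iff_forall_notMem.1 hd) _ ⟨⟨F, hI.finite_mem F.finite_toSet, ?_⟩, h⟩
  ext d
  simp

end Separation

/-! ### Fubini powers of Fin -/

section FinPow

theorem mem_finPowSucc_succ_iff_cons {n : ℕ} {A : Set (Fin (n + 2) → ℕ)} :
    A ∈ finPowSucc (n + 1) ↔
      {i : ℕ | {t : Fin (n + 1) → ℕ | (Fin.cons i t : Fin (n + 2) → ℕ) ∈ A} ∉ finPowSucc n}.Finite :=
  Iff.rfl

theorem isIdealOn_finPowSucc (n : ℕ) : IsIdealOn (finPowSucc n) := by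
  induction n with
  | zero =>
    exact ⟨fun h hB => Finite.subset hB h, fun hA hB => Finite.union hA hB, fun h => h,
      fun h => infinite_univ h⟩
  | succ n ih =>
    refine ⟨fun {A B} hAB hB => ?_, fun {A B} hA hB => ?_, fun {A} hA => ?_, fun h => ?_⟩
    · rw [mem_finPowSucc_succ_iff_cons] at hB ⊢
      refine hB.subset fun i hi hiB => hi (ih.subset_mem ?_ hiB)
      exact fun t ht => hAB ht
    · rw [mem_finPowSucc_succ_iff_cons] at hA hB ⊢
      refine (hA.union hB).subset fun i hi => ?_
      by_contra hc
      simp only [mem_union, mem_ofPred_eq, not_or, not_not] at hc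
      exact hi (ih.union_mem hc.1 hc.2)
    · rw [mem_finPowSucc_succ_iff_cons]
      convert finite_empty (α := ℕ)
      refine eq_empty_of_forall_notMem fun i hi => hi (ih.finite_mem ?_)
      exact hA.preimage (Fin.cons_right_injective (α := fun _ => ℕ) i).injOn
    · rw [mem_finPowSucc_succ_iff_cons] at h
      refine infinite_univ (h.subset fun i _ hi => ih.univ_notMem ?_)
      simpa using hi

/-- Associativity of the Fubini product: the definition splits off the first coordinate, whereas
lowering the separation class needs Fin as the last factor. -/
theorem mem_finPowSucc_succ_iff_snoc {n : ℕ} {A : Set (Fin (n + 2) → ℕ)} :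
    A ∈ finPowSucc (n + 1) ↔
      {s : Fin (n + 1) → ℕ | {k : ℕ | (Fin.snoc s k : Fin (n + 2) → ℕ) ∈ A}.Infinite} ∈
        finPowSucc n := by
  induction n with
  | zero =>
    rw [mem_finPowSucc_succ_iff_cons]
    have h (i : ℕ) : {t : Fin 1 → ℕ | (Fin.cons i t : Fin 2 → ℕ) ∈ A} ∉ finPowSucc 0 ↔
        {k : ℕ | (Fin.snoc (fun _ => i : Fin 1 → ℕ) k : Fin 2 → ℕ) ∈ A}.Infinite := by
      change Set.Infinite _ ↔ _
      rw [← infinite_image_iff (f := Equiv.funUnique (Fin 1) ℕ) (Equiv.injective _).injOn,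
        Equiv.image_eq_preimage_symm]
      have heq (k : ℕ) : (Fin.cons i ((Equiv.funUnique (Fin 1) ℕ).symm k) : Fin 2 → ℕ) =
          Fin.snoc (fun _ => i : Fin 1 → ℕ) k := by
        ext j
        fin_cases j <;> rfl
      simp only [preimage_ofPred_eq, heq]
    simp only [h]
    change Set.Finite _ ↔ Set.Finite _
    rw [← finite_image_iff (f := Equiv.funUnique (Fin 1) ℕ) (Equiv.injective _).injOn,
      Equiv.image_eq_preimage_symm]
    rfl
  | succ n ih =>
    rw [mem_finPowSucc_succ_iff_cons, mem_finPowSucc_succ_iff_cons]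
    simp only [ih, mem_ofPred_eq, Fin.cons_snoc_eq_snoc_cons]

theorem not_sigmaSeparated_finPowSucc (n k : ℕ) (hk : k ≤ n) :
    ¬ SigmaSeparated ((k + 1 : ℕ) : Ordinal.{0}) (finPowSucc n) := by
  induction n generalizing k with
  | zero =>
    obtain rfl : k = 0 := by omega
    simpa using not_sigmaSeparated_one (isIdealOn_finPowSucc 0)
  | succ n ih =>
    rcases k with _ | k
    · rw [zero_add, Nat.cast_one]
      exact not_sigmaSeparated_one (isIdealOn_finPowSucc _)
    · intro h
      refine ih k (by omega) (SigmaSeparated.of_fubiniProduct (h.preimage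
        ((Fin.snocEquiv fun _ : Fin (n + 2) => ℕ).symm.trans (Equiv.prodComm _ _)) fun A => ?_))
      rw [mem_finPowSucc_succ_iff_snoc]
      have hset (s : Fin (n + 1) → ℕ) : {k : ℕ | (Fin.snoc s k : Fin (n + 2) → ℕ) ∈
          ((Fin.snocEquiv fun _ : Fin (n + 2) => ℕ).symm.trans (Equiv.prodComm _ _)) ⁻¹' A} =
          {k | (s, k) ∈ A} := by
        ext k
        simp [Fin.snocEquiv]
      simp only [hset]
      rfl

/-- Each coordinate of `c` contributes one application of `cofinite_fibers`, that is, two steps. -/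
theorem finGenerated_infinite_fibers {D : Type*} (n : ℕ) (c : D → Fin (n + 1) → ℕ) :
    FinGenerated (2 * n + 2) {A | {s | (A ∩ c ⁻¹' {s}).Infinite} ∈ finPowSucc n} := by
  induction n with
  | zero =>
    have h := FinGenerated.fin.cofinite_fibers fun a => c a 0
    convert h using 2
    change {A | Set.Finite _} = _
    ext A
    simp only [mem_ofPred_eq]
    rw [← finite_image_iff (f := Equiv.funUnique (Fin 1) ℕ) (Equiv.injective _).injOn,
      Equiv.image_eq_preimage_symm]
    have heq (k : ℕ) : c ⁻¹' {(Equiv.funUnique (Fin 1) ℕ).symm k} = (fun a => c a 0) ⁻¹' {k} := by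
      ext a
      simp [funext_iff]
    simp only [preimage_ofPred_eq, heq]
    rfl
  | succ n ih =>
    have hI := ih fun a => Fin.tail (c a)
    have h := hI.cofinite_fibers fun a => c a 0
    rw [show 2 * (n + 1) + 2 = 2 * n + 2 + 2 by ring]
    convert h using 2
    ext A
    rw [mem_finPowSucc_succ_iff_cons]
    have heq (i : ℕ) (t : Fin (n + 1) → ℕ) : c ⁻¹' {(Fin.cons i t : Fin (n + 2) → ℕ)} =
        (fun a => c a 0) ⁻¹' {i} ∩ (fun a => Fin.tail (c a)) ⁻¹' {t} := by
      ext a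
      simp only [mem_preimage, mem_singleton_iff, mem_inter_iff]
      exact ⟨fun h => by simp [h], fun ⟨h, h'⟩ => by rw [← Fin.cons_self_tail (c a), h, h']⟩
    simp only [mem_ofPred_eq, heq, inter_assoc]

end FinPow

/-! ### Copies of Fubini powers along a partition -/

section Copies

variable {n : ℕ} {Y : (Fin (n + 1) → ℕ) → Set ℕ}

/-- The family of the subsets `A` of `ω` that have an infinite intersection with `Y s` only for
a set of indices `s` in `Fin^(n+1)`. -/
def infiniteTraceIdeal (n : ℕ) (Y : (Fin (n + 1) → ℕ) → Set ℕ) : Set (Set ℕ) :=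
  {A | {s | (A ∩ Y s).Infinite} ∈ finPowSucc n}

theorem exists_equiv_prod (hinf : ∀ s, (Y s).Infinite)
    (hdisj : ∀ s t, s ≠ t → Disjoint (Y s) (Y t)) (hcov : ⋃ s, Y s = Set.univ) :
    ∃ e : (Fin (n + 1) → ℕ) × ℕ ≃ ℕ, ∀ s, range (fun k => e (s, k)) = Y s := by
  classical
  have f (s) : ℕ ≃ Y s :=
    haveI := (hinf s).to_subtype
    letI := Classical.choice (nonempty_denumerable (Y s))
    (Denumerable.eqv (Y s)).symm
  have hf (s) : range (fun k => (f s k : ℕ)) = Y s := by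
    rw [range_comp' Subtype.val (f s), (f s).range_eq_univ, image_univ, Subtype.range_coe]
  let g : (Fin (n + 1) → ℕ) × ℕ → ℕ := fun p => f p.1 p.2
  have hg : Function.Bijective g := by
    constructor
    · rintro ⟨s, k⟩ ⟨t, l⟩ h
      obtain rfl : s = t := by
        by_contra hst
        refine disjoint_left.1 (hdisj s t hst) (f s k).2 ?_
        rw [show (f s k : ℕ) = f t l from h]
        exact (f t l).2
      have : f s k = f s l := Subtype.ext h
      rw [(f s).injective this]
    · intro x
      obtain ⟨s, hs⟩ := mem_iUnion.1 (hcov ▸ Set.mem_univ x)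
      rw [← hf s] at hs
      obtain ⟨k, hk⟩ := hs
      exact ⟨(s, k), hk⟩
  exact ⟨Equiv.ofBijective g hg, hf⟩

theorem inter_infinite_iff_of_range_eq {e : (Fin (n + 1) → ℕ) × ℕ ≃ ℕ}
    {s : Fin (n + 1) → ℕ} (he : range (fun k => e (s, k)) = Y s) (A : Set ℕ) :
    (A ∩ Y s).Infinite ↔ {k | e (s, k) ∈ A}.Infinite := by
  have hinj : Function.Injective fun k => e (s, k) :=
    e.injective.comp (Prod.mk_right_injective s)
  rw [← he, ← image_preimage_eq_inter_range, infinite_image_iff hinj.injOn]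
  rfl

/-- Splitting off the last coordinate, membership of `σ ⁻¹' A` depends only on which blocks `A`
meets infinitely, hence not on `σ`. -/
theorem finPowCopy_eq (hinf : ∀ s, (Y s).Infinite)
    (hdisj : ∀ s t, s ≠ t → Disjoint (Y s) (Y t)) (hcov : ⋃ s, Y s = Set.univ) :
    finPowCopy n Y = infiniteTraceIdeal n Y := by
  let c : (Fin (n + 1) → ℕ) × ℕ ≃ (Fin (n + 2) → ℕ) :=
    (Equiv.prodComm _ _).trans (Fin.snocEquiv fun _ : Fin (n + 2) => ℕ)
  have hc (s : Fin (n + 1) → ℕ) (k : ℕ) : c (s, k) = Fin.snoc s k := rfl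
  have hset (s : Fin (n + 1) → ℕ) (σ : (Fin (n + 2) → ℕ) ≃ ℕ) :
      σ '' {u | ∃ k : ℕ, u = Fin.snoc s k} = range fun k => (c.trans σ) (s, k) := by
    ext x
    simp only [mem_image, mem_ofPred_eq, mem_range, Equiv.trans_apply, hc]
    constructor
    · rintro ⟨_, ⟨k, rfl⟩, rfl⟩
      exact ⟨k, rfl⟩
    · rintro ⟨k, rfl⟩
      exact ⟨_, ⟨k, rfl⟩, rfl⟩
  have key (σ : (Fin (n + 2) → ℕ) ≃ ℕ)
      (hσ : ∀ s : Fin (n + 1) → ℕ, σ '' {u | ∃ k : ℕ, u = Fin.snoc s k} = Y s) (A : Set ℕ) :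
      σ ⁻¹' A ∈ finPowSucc (n + 1) ↔ A ∈ infiniteTraceIdeal n Y := by
    rw [mem_finPowSucc_succ_iff_snoc, infiniteTraceIdeal, mem_ofPred_eq]
    simp only [fun s => inter_infinite_iff_of_range_eq ((hset s σ).symm.trans (hσ s)) A]
    rfl
  ext A
  constructor
  · rintro ⟨σ, hσ, hA⟩
    exact (key σ hσ A).1 hA
  · intro hA
    obtain ⟨e, he⟩ := exists_equiv_prod hinf hdisj hcov
    have hσ (s : Fin (n + 1) → ℕ) :
        (c.symm.trans e) '' {u | ∃ k : ℕ, u = Fin.snoc s k} = Y s := by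
      rw [hset s, ← he s]
      simp
    exact ⟨c.symm.trans e, hσ, (key _ hσ A).2 hA⟩

theorem finGenerated_infiniteTraceIdeal
    (hdisj : ∀ s t, s ≠ t → Disjoint (Y s) (Y t)) (hcov : ⋃ s, Y s = Set.univ) :
    FinGenerated (2 * n + 2) (infiniteTraceIdeal n Y) := by
  have hex (x : ℕ) : ∃ s, x ∈ Y s := mem_iUnion.1 (hcov ▸ Set.mem_univ x)
  choose c hc using hex
  have hfib (s) : Y s = c ⁻¹' {s} := by
    ext x
    refine ⟨fun hx => ?_, fun hx => ?_⟩
    · by_contra hne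
      exact disjoint_left.1 (hdisj _ _ hne) (hc x) hx
    · rw [← show c x = s from hx]
      exact hc x
  simp only [infiniteTraceIdeal, hfib]
  exact finGenerated_infinite_fibers n c

theorem not_sigmaSeparated_infiniteTraceIdeal (hinf : ∀ s, (Y s).Infinite)
    (hdisj : ∀ s t, s ≠ t → Disjoint (Y s) (Y t)) (hcov : ⋃ s, Y s = Set.univ)
    (k : ℕ) (hk : k ≤ n) :
    ¬ SigmaSeparated ((k + 1 + 1 : ℕ) : Ordinal.{0}) (infiniteTraceIdeal n Y) := by
  intro h
  obtain ⟨e, he⟩ := exists_equiv_prod hinf hdisj hcov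
  refine not_sigmaSeparated_finPowSucc n k hk
    (SigmaSeparated.of_fubiniProduct (h.preimage e.symm fun A => ?_))
  rw [infiniteTraceIdeal, mem_ofPred_eq]
  simp only [fun s => inter_infinite_iff_of_range_eq (he s)]
  have hset (s : Fin (n + 1) → ℕ) : {k | e (s, k) ∈ e.symm ⁻¹' A} = {k | (s, k) ∈ A} := by
    ext k
    simp
  simp only [hset]
  rfl

end Copies

/-! ### Generated ideals -/

section GeneratedIdeal

variable {D : Type*} {F : Set (Set D)} {A B : Set D}

theorem subset_generatedIdeal (F : Set (Set D)) : F ⊆ generatedIdeal F :=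
  fun A hA => ⟨0, fun _ => A, fun _ => hA, fun _ ha => mem_iUnion.2 ⟨0, ha⟩⟩

theorem generatedIdeal_subset_mem (hAB : A ⊆ B) (hB : B ∈ generatedIdeal F) :
    A ∈ generatedIdeal F := by
  obtain ⟨n, f, hf, h⟩ := hB
  exact ⟨n, f, hf, hAB.trans h⟩

theorem generatedIdeal_union_mem (hA : A ∈ generatedIdeal F) (hB : B ∈ generatedIdeal F) :
    A ∪ B ∈ generatedIdeal F := by
  obtain ⟨n, f, hf, hAf⟩ := hA
  obtain ⟨m, g, hg, hBg⟩ := hB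
  refine ⟨n + 1 + m, (Fin.append f g : Fin (n + 1 + (m + 1)) → Set D), fun i => ?_, union_subset ?_ ?_⟩
  · refine Fin.addCases (m := n + 1) (n := m + 1) (fun j => ?_) (fun j => ?_) i
    · rw [Fin.append_left]
      exact hf j
    · rw [Fin.append_right]
      exact hg j
  · refine hAf.trans (iUnion_subset fun j => ?_)
    rw [← Fin.append_left f g j]
    exact subset_iUnion (Fin.append f g) _
  · refine hBg.trans (iUnion_subset fun j => ?_)
    rw [← Fin.append_right f g j]
    exact subset_iUnion (Fin.append f g) _

end GeneratedIdeal

/-! ### The ideal as a union of finite joins, and its rank -/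

section FinPrimeOmega

variable {X : (n : ℕ) → (Fin (n + 1) → ℕ) → Set ℕ}

/-- The ideal generated by the first `N + 1` of the ideals `infiniteTraceIdeal n (X n)`. -/
def finPrimeStage (X : (n : ℕ) → (Fin (n + 1) → ℕ) → Set ℕ) : ℕ → Set (Set ℕ)
  | 0 => infiniteTraceIdeal 0 (X 0)
  | N + 1 => joinFamily (finPrimeStage X N) (infiniteTraceIdeal (N + 1) (X (N + 1)))

namespace IsIndependentPartitions

theorem finPowCopy_eq (hX : IsIndependentPartitions X) (n : ℕ) :
    finPowCopy n (X n) = infiniteTraceIdeal n (X n) :=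
  _root_.finPowCopy_eq (hX.infinite n) (hX.disjoint n) (hX.cover n)

theorem finGenerated_infiniteTraceIdeal (hX : IsIndependentPartitions X) (n : ℕ) :
    FinGenerated (2 * n + 2) (infiniteTraceIdeal n (X n)) :=
  _root_.finGenerated_infiniteTraceIdeal (hX.disjoint n) (hX.cover n)

theorem exists_finGenerated_finPrimeStage (hX : IsIndependentPartitions X) (N : ℕ) :
    ∃ k, FinGenerated k (finPrimeStage X N) := by
  induction N with
  | zero => exact ⟨_, hX.finGenerated_infiniteTraceIdeal 0⟩
  | succ N ih =>
    obtain ⟨k, hk⟩ := ih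
    exact ⟨_, hk.join (hX.finGenerated_infiniteTraceIdeal (N + 1))⟩

theorem monotone_finPrimeStage (hX : IsIndependentPartitions X) : Monotone (finPrimeStage X) :=
  monotone_nat_of_le_succ fun N A hA => ⟨A, hA, ∅,
    (hX.finGenerated_infiniteTraceIdeal (N + 1)).finite_mem finite_empty, (union_empty A).symm⟩

theorem infiniteTraceIdeal_subset_finPrimeStage (hX : IsIndependentPartitions X) (n : ℕ) :
    infiniteTraceIdeal n (X n) ⊆ finPrimeStage X n := by
  rcases n with _ | n
  · exact subset_rfl
  · obtain ⟨k, hk⟩ := hX.exists_finGenerated_finPrimeStage n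
    exact fun A hA => ⟨∅, hk.finite_mem finite_empty, A, hA, (empty_union A).symm⟩

theorem infiniteTraceIdeal_subset_finPrimeOmega (hX : IsIndependentPartitions X) (n : ℕ) :
    infiniteTraceIdeal n (X n) ⊆ finPrimeOmega X := by
  rw [← hX.finPowCopy_eq]
  exact (subset_iUnion (fun n => finPowCopy n (X n)) n).trans (subset_generatedIdeal _)

theorem finPrimeOmega_eq_iUnion (hX : IsIndependentPartitions X) :
    finPrimeOmega X = ⋃ N, finPrimeStage X N := by
  apply Subset.antisymm
  · rintro A ⟨m, f, hf, hA⟩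
    have hf' (i) : ∃ N, f i ∈ finPrimeStage X N := by
      obtain ⟨n, hn⟩ := mem_iUnion.1 (hf i)
      rw [hX.finPowCopy_eq] at hn
      exact ⟨n, hX.infiniteTraceIdeal_subset_finPrimeStage n hn⟩
    choose N hN using hf'
    obtain ⟨k, hk⟩ := hX.exists_finGenerated_finPrimeStage (Finset.univ.sup N)
    refine mem_iUnion.2 ⟨Finset.univ.sup N, hk.subset_mem hA ?_⟩
    have h (s : Finset (Fin (m + 1))) : ⋃ i ∈ s, f i ∈ finPrimeStage X (Finset.univ.sup N) := by
      classical
      induction s using Finset.induction_on with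
      | empty => exact hk.finite_mem (by simp)
      | insert i s _ ih =>
        rw [Finset.set_biUnion_insert]
        exact hk.union_mem (hX.monotone_finPrimeStage (Finset.le_sup (Finset.mem_univ i)) (hN i)) ih
    simpa using h Finset.univ
  · refine iUnion_subset fun N => ?_
    induction N with
    | zero => exact hX.infiniteTraceIdeal_subset_finPrimeOmega 0
    | succ N ih =>
      rintro _ ⟨B, hB, C, hC, rfl⟩
      exact generatedIdeal_union_mem (ih hB) (hX.infiniteTraceIdeal_subset_finPrimeOmega _ hC)

/-- Fin^(n+1) is proper, so a member of the n-th copy meets some block finitely. One such block per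
partition yields an intersection which independence will make infinite, so ω is in no stage. -/
theorem exists_finite_inter_of_mem_finPrimeStage (N : ℕ)
    {A : Set ℕ} (hA : A ∈ finPrimeStage X N) :
    ∃ s : (i : ℕ) → Fin (i + 1) → ℕ, (A ∩ ⋂ i ∈ Finset.range (N + 1), X i (s i)).Finite := by
  have h (n : ℕ) (B : Set ℕ) (hB : B ∈ infiniteTraceIdeal n (X n)) :
      ∃ s, (B ∩ X n s).Finite := by
    by_contra! hc
    refine (isIdealOn_finPowSucc n).univ_notMem ?_
    convert show {s | (B ∩ X n s).Infinite} ∈ finPowSucc n from hB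
    exact (eq_univ_of_forall hc).symm
  induction N generalizing A with
  | zero =>
    obtain ⟨s, hs⟩ := h 0 A hA
    exact ⟨Function.update (fun _ _ => 0) 0 s, by simpa using hs⟩
  | succ N ih =>
    obtain ⟨B, hB, C, hC, rfl⟩ := hA
    obtain ⟨s, hs⟩ := ih hB
    obtain ⟨t, ht⟩ := h _ C hC
    refine ⟨Function.update s (N + 1) t, (hs.union ht).subset ?_⟩
    rintro a ⟨ha, hi⟩
    simp only [mem_iInter, Finset.mem_range] at hi
    rcases ha with ha | ha
    · refine Or.inl ⟨ha, ?_⟩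
      simp only [mem_iInter, Finset.mem_range]
      intro i hiN
      have := hi i (by omega)
      rwa [Function.update_of_ne (by omega)] at this
    · have := hi (N + 1) (by omega)
      rw [Function.update_self] at this
      exact Or.inr ⟨ha, this⟩

theorem isIdealOn_finPrimeOmega (hX : IsIndependentPartitions X) :
    IsIdealOn (finPrimeOmega X) where
  subset_mem := generatedIdeal_subset_mem
  union_mem := generatedIdeal_union_mem
  finite_mem hA := hX.infiniteTraceIdeal_subset_finPrimeOmega 0
    ((hX.finGenerated_infiniteTraceIdeal 0).finite_mem hA)
  univ_notMem h := by
    rw [hX.finPrimeOmega_eq_iUnion] at h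
    obtain ⟨N, hN⟩ := mem_iUnion.1 h
    obtain ⟨s, hs⟩ := exists_finite_inter_of_mem_finPrimeStage N hN
    rw [univ_inter] at hs
    exact hX.inter_infinite _ s hs

theorem isSigma0Family_finPrimeOmega (hX : IsIndependentPartitions X) :
    IsSigma0Family ω (finPrimeOmega X) := by
  have h : {x : ℕ → Bool | {d | x d = true} ∈ finPrimeOmega X} =
      ⋃ N, {x : ℕ → Bool | {d | x d = true} ∈ finPrimeStage X N} := by
    ext x
    simp [hX.finPrimeOmega_eq_iUnion]
  unfold IsSigma0Family
  rw [h]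
  refine .iUnion_of_compl one_lt_omega0 fun N => ?_
  obtain ⟨k, hk⟩ := hX.exists_finGenerated_finPrimeStage N
  -- The extra 1 pays for the complement required in the definition of Σ⁰_ω.
  refine ⟨((2 * k + 2 + 1 : ℕ) : Ordinal.{0}), natCast_lt_omega0 _, ?_⟩
  have := IsSigma0.compl hk.isSigma0Family
  exact_mod_cast this

theorem hasBorelSeparationRank_finPrimeOmega (hX : IsIndependentPartitions X) :
    HasBorelSeparationRank (finPrimeOmega X) ω := by
  have hI := hX.isIdealOn_finPrimeOmega
  refine ⟨⟨omega0_lt_omega_one, finPrimeOmega X, ?_, subset_rfl, ?_⟩, ?_⟩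
  · rw [one_add_omega0]
    exact hX.isSigma0Family_finPrimeOmega
  · refine eq_empty_of_forall_notMem ?_
    rintro _ ⟨⟨A, hA, rfl⟩, hAc⟩
    exact hI.univ_notMem (union_compl_self A ▸ hI.union_mem hA hAc)
  · rintro β ⟨-, hS⟩
    by_contra! hβ
    obtain ⟨b, rfl⟩ := lt_omega0.1 hβ
    have hsep : SigmaSeparated (1 + (b : Ordinal.{0})) (finPrimeOmega X) := hS
    rcases b with _ | b
    · rw [Nat.cast_zero, add_zero] at hsep
      exact not_sigmaSeparated_one hI hsep
    -- Rank b + 1 would mean Σ⁰_(b+2) separation, which already fails for the copy of Fin^(b+2)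
    -- contained in the ideal.
    · refine not_sigmaSeparated_infiniteTraceIdeal (hX.infinite b) (hX.disjoint b) (hX.cover b)
        b le_rfl ?_
      rw [show 1 + ((b + 1 : ℕ) : Ordinal.{0}) = ((b + 1 + 1 : ℕ) : Ordinal.{0}) by
        norm_cast; ring] at hsep
      exact hsep.anti (hX.infiniteTraceIdeal_subset_finPrimeOmega b)

end IsIndependentPartitions

end FinPrimeOmega

theorem theorem4p5 (X : (n : ℕ) → (Fin (n + 1) → ℕ) → Set ℕ) (hX : IsIndependentPartitions X) :
    IsIdealOn (finPrimeOmega X) ∧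
      IsSigma0Family Ordinal.omega0 (finPrimeOmega X) ∧
      HasBorelSeparationRank (finPrimeOmega X) Ordinal.omega0 :=
  ⟨hX.isIdealOn_finPrimeOmega, hX.isSigma0Family_finPrimeOmega,
    hX.hasBorelSeparationRank_finPrimeOmega⟩
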